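/- Let $\Bbbk$ be an algebraically closed field, let $A$ be a finite-dimensional (associative, unital) $\Bbbk$-algebra, let $\mathscr{I}$ be a two-sided ideal of $A$, and let $B=A/\mathscr{I}$. Then $$\mathrm{fpd}_B(\tau_B)\leqslant \mathrm{fpd}_A(\tau_A).$$ Here, for a finite-dimensional $\Bbbk$-algebra $R$, $\mathrm{mod}\,R$ is the category of finite-dimensional left $R$-modules, and $\tau_R=D\,\mathrm{Tr}$ is its Auslander–Reiten translation: if $P_1\xrightarrow{d}P_0\to M\to 0$ is a minimal projective presentation of $M$, then $\mathrm{Tr}\,M=\mathrm{coker}\big(\mathrm{Hom}_R(P_0,R)\xrightarrow{\;d^*\;}\mathrm{Hom}_R(P_1,R)\big)$ and $D=\mathrm{Hom}_\Bbbk(-,\Bbbk)$. A brick set in $\mathrm{mod}\,R$ is a finite nonempty set $\{X_1,\dots,X_n\}$ of objects with $\dim_\Bbbk\mathrm{Hom}_R(X_i,X_j)=\delta_{ij}$ for all $i,j$, and $$\mathrm{fpd}_R(\tau_R)=\sup_{n\ge 1}\ \sup_{\{X_1,\dots,X_n\}}\ \rho\Big(\big(\dim_\Bbbk \mathrm{Hom}_R(X_i,\tau_R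 X_j)\big)_{i,j=1}^n\Big)\in\mathbb{R}\cup\{\pm\infty\},$$ where the inner supremum is over all brick sets with $n$ elements and $\rho$ denotes the spectral radius (the largest absolute value of a complex eigenvalue); the supremum of the empty set is $-\infty$. -/

import Mathlib

open CategoryTheory
open scoped ModuleCat

universe u

namespace FPDim

/-! ### Spectral radius of matrices with extended real entries -/

section SpectralRadius

variable {n : ℕ}

/-- The spectral radius of a real square matrix: the largest absolute value of its complex
eigenvalues. -/
noncomputable def realRho (M : Matrix (Fin n) (Fin n) ℝ) : EReal :=
  ((spectralRadius ℂ (M.map (fun r : ℝ => (r : ℂ))) : ENNReal) : EReal)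

/-- Replace the entries `∞` and `-∞` of `M` at position `(i, j)` by `x i j` and `- x i j`. -/
noncomputable def realize (M : Matrix (Fin n) (Fin n) EReal) (x : Fin n → Fin n → ℝ) :
    Matrix (Fin n) (Fin n) ℝ :=
  open Classical in
  Matrix.of fun i j =>
    if M i j = ⊤ then x i j else if M i j = ⊥ then - x i j else (M i j).toReal

/-- The spectral radius of a square matrix with extended real entries: the limit inferior of the
spectral radii of its real replacements, as all the replacing numbers tend to infinity. -/
noncomputable def rho (M : Matrix (Fin n) (Fin n) EReal) : EReal :=
  Filter.liminf (fun x : Fin n → Fin n → ℝ => realRho (realize M x)) Filter.atTop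

end SpectralRadius

/-! ### Frobenius-Perron dimension in a linear category -/

section FrobeniusPerron

variable (k : Type u) [Field k] {C : Type*} [Category C] [Preadditive C] [Linear k C]

/-- The dimension of `Hom(X, Y)`, as an extended real number. -/
noncomputable def homDim (X Y : C) : EReal :=
  (((Module.rank k (X ⟶ Y)).toENat : ENNReal) : EReal)

/-- `X 0, …, X (n - 1)` is a brick set: `dim Hom(X i, X j)` is `1` for `i = j` (that is, each
`X i` is a brick) and `0` otherwise. In particular, the `X i` are nonzero and distinct. -/
def IsBrickSet {n : ℕ} (X : Fin n → C) : Prop :=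
  ∀ i j, Module.rank k (X i ⟶ X j) = if i = j then 1 else 0

/-- The adjacency matrix `(dim Hom(X i, σ (X j)))`. -/
noncomputable def adjacencyMatrix (σ : C → C) {n : ℕ} (X : Fin n → C) :
    Matrix (Fin n) (Fin n) EReal :=
  Matrix.of fun i j => homDim k (X i) (σ (X j))

/-- The `n`-th Frobenius-Perron dimension of the assignment `σ`. -/
noncomputable def fpdNth (σ : C → C) (n : ℕ) : EReal :=
  ⨆ X : {X : Fin n → C // IsBrickSet k X}, rho (adjacencyMatrix k σ X.1)

/-- The Frobenius-Perron dimension of the assignment `σ`. -/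
noncomputable def fpd (σ : C → C) : EReal :=
  ⨆ n : {n : ℕ // 1 ≤ n}, fpdNth k σ n.1

end FrobeniusPerron

/-! ### Projective covers over an artinian ring -/

section ProjectiveCover

variable {A : Type u} [Ring A]

/-- `p : P → M` is a projective cover: `P` is projective, and `p` is surjective with superfluous
kernel. -/
structure IsProjectiveCover {P M : Type u} [AddCommGroup P] [Module A P] [AddCommGroup M]
    [Module A M] (p : P →ₗ[A] M) : Prop where
  projective : Module.Projective A P
  surjective : Function.Surjective p
  superfluous : ∀ N : Submodule A P, N ⊔ LinearMap.ker p = ⊤ → N = ⊤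

variable (A) in
theorem exists_projectiveCover [IsArtinianRing A] (M : Type u) [AddCommGroup M] [Module A M]
    [Module.Finite A M] :
    ∃ (P : ModuleCat.{u} A) (p : P →ₗ[A] M), Module.Finite A P ∧ IsProjectiveCover p := by
  obtain ⟨n, π, hπ⟩ := Module.Finite.exists_fin' A M
  let S : Set (Submodule A (Fin n → A)) :=
    {N | Module.Projective A N ∧ N.map π = ⊤}
  have hS : S.Nonempty := by
    refine ⟨⊤, ?_, ?_⟩
    · exact Module.Projective.of_equiv (Submodule.topEquiv (R := A) (M := Fin n → A)).symm
    · rw [Submodule.map_top, LinearMap.range_eq_top.2 hπ]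
  obtain ⟨N, ⟨hNp, hNs⟩, hmin⟩ := WellFounded.has_min
    (IsWellFounded.wf : WellFounded ((· < ·) : Submodule A (Fin n → A) → _ → Prop)) S hS
  let p : N →ₗ[A] M := π ∘ₗ N.subtype
  have hp : Function.Surjective p := by
    intro m
    have : m ∈ N.map π := by rw [hNs]; trivial
    obtain ⟨x, hx, rfl⟩ := this
    exact ⟨⟨x, hx⟩, rfl⟩
  refine ⟨ModuleCat.of A N, p, inferInstanceAs (Module.Finite A N), hNp, hp, ?_⟩
  intro (L : Submodule A N) hL
  have hLs : Function.Surjective (p ∘ₗ L.subtype) := by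
    intro m
    obtain ⟨x, rfl⟩ := hp m
    have hx : x ∈ L ⊔ LinearMap.ker p := by rw [hL]; trivial
    obtain ⟨y, hy, z, hz, rfl⟩ := Submodule.mem_sup.1 hx
    refine ⟨⟨y, hy⟩, ?_⟩
    have hz' : p z = 0 := hz
    simp [hz']
  obtain ⟨g, hg⟩ := Module.projective_lifting_property (p ∘ₗ L.subtype) p hLs
  let e : Module.End A N := L.subtype ∘ₗ g
  have he : p ∘ₗ e = p := hg
  have hpow : ∀ m : ℕ, p ∘ₗ (e ^ m) = p := by
    intro m
    induction m with
    | zero => rfl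
    | succ m ih =>
      rw [pow_succ, Module.End.mul_eq_comp, ← LinearMap.comp_assoc, ih, he]
  obtain ⟨m, hm⟩ := Filter.eventually_atTop.1 (LinearMap.eventually_isCompl_ker_pow_range_pow e)
  have hc := hm (m + 1) (Nat.le_succ m)
  let R : Submodule A N := LinearMap.range (e ^ (m + 1))
  have hRL : R ≤ L := by
    rintro _ ⟨x, rfl⟩
    rw [pow_succ']
    exact (g ((e ^ m) x)).2
  have hRproj : Module.Projective A R :=
    Module.Projective.of_split R.subtype (R.projectionOnto _ hc.symm)
      (by ext x; simp)
  have hmem : R.map N.subtype ∈ S := by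
    refine ⟨?_, ?_⟩
    · exact Module.Projective.of_equiv
        (Submodule.equivMapOfInjective N.subtype N.injective_subtype R)
    · rw [← Submodule.map_comp, eq_top_iff]
      rintro y -
      obtain ⟨x, rfl⟩ := hp y
      exact ⟨(e ^ (m + 1)) x, ⟨x, rfl⟩, LinearMap.congr_fun (hpow (m + 1)) x⟩
  have hle : R.map N.subtype ≤ N := Submodule.map_subtype_le N R
  have heq : R.map N.subtype = N := by
    by_contra hne
    exact hmin _ hmem (lt_of_le_of_ne hle hne)
  rw [eq_top_iff]
  rintro x -
  apply hRL
  have hx : (x : Fin n → A) ∈ R.map N.subtype := by rw [heq]; exact x.2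
  obtain ⟨y, hy, hyx⟩ := hx
  have : y = x := Subtype.ext hyx
  exact this ▸ hy

variable (A) [IsArtinianRing A] (M : Type u) [AddCommGroup M] [Module A M] [Module.Finite A M]

/-- A projective cover of `M`. -/
noncomputable def projCover : ModuleCat.{u} A :=
  (exists_projectiveCover A M).choose

/-- The projection of the projective cover onto `M`. -/
noncomputable def projCoverMap : projCover A M →ₗ[A] M :=
  (exists_projectiveCover A M).choose_spec.choose

instance projCover_finite : Module.Finite A (projCover A M) :=
  (exists_projectiveCover A M).choose_spec.choose_spec.1

theorem projCoverMap_isProjectiveCover : IsProjectiveCover (projCoverMap A M) :=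
  (exists_projectiveCover A M).choose_spec.choose_spec.2

/-- The term `P₀` of a minimal projective presentation `P₁ → P₀ → M → 0`. -/
noncomputable abbrev presZero : ModuleCat.{u} A := projCover A M

/-- The term `P₁` of a minimal projective presentation `P₁ → P₀ → M → 0`: a projective cover of
the kernel of `P₀ → M`. -/
noncomputable abbrev presOne : ModuleCat.{u} A :=
  projCover A (LinearMap.ker (projCoverMap A M))

/-- The map `P₁ → P₀` of a minimal projective presentation `P₁ → P₀ → M → 0`. -/
noncomputable def presMap : presOne A M →ₗ[A] presZero A M :=
  (LinearMap.ker (projCoverMap A M)).subtype ∘ₗ projCoverMap A (LinearMap.ker (projCoverMap A M))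

end ProjectiveCover

/-! ### The Auslander-Reiten translation `τ = D Tr` -/

section Transpose

variable {A : Type u} [Ring A] {P Q : Type u} [AddCommGroup P] [Module A P] [AddCommGroup Q]
  [Module A Q]

/-- The map `Hom(f, A) : Hom(Q, A) → Hom(P, A)` of right `A`-modules, for a map `f : P → Q` of
left `A`-modules; the right action is `(g · a) x = g x * a`. -/
def homToRing (f : P →ₗ[A] Q) : (Q →ₗ[A] A) →ₗ[Aᵐᵒᵖ] (P →ₗ[A] A) where
  toFun g := g ∘ₗ f
  map_add' _ _ := rfl
  map_smul' _ _ := rfl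

/-- The transpose `Tr M`, a right `A`-module: the cokernel of `Hom(P₀, A) → Hom(P₁, A)` for a
minimal projective presentation `P₁ → P₀ → M → 0`. -/
noncomputable def transpose (A : Type u) [Ring A] [IsArtinianRing A] (M : Type u)
    [AddCommGroup M] [Module A M] [Module.Finite A M] : ModuleCat.{u} Aᵐᵒᵖ :=
  ModuleCat.of Aᵐᵒᵖ ((presOne A M →ₗ[A] A) ⧸ LinearMap.range (homToRing (presMap A M)))

end Transpose

section Dual

variable (k : Type u) [Field k] {A : Type u} [Ring A] [Algebra k A]

/-- The underlying space of `D N = Hom_k(N, k)`, for a right `A`-module `N`. -/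
def RightDual (N : ModuleCat.{u} Aᵐᵒᵖ) : Type u := N →ₗ[k] k

variable {k} in
/-- An element of `D N`, as a linear form on `N`. -/
def RightDual.lin {N : ModuleCat.{u} Aᵐᵒᵖ} (φ : RightDual k N) : N →ₗ[k] k := φ

noncomputable instance (N : ModuleCat.{u} Aᵐᵒᵖ) : AddCommGroup (RightDual k N) :=
  inferInstanceAs (AddCommGroup (N →ₗ[k] k))

/-- Right multiplication by `a` on a right `A`-module, as a `k`-linear map. -/
def rightMul (N : ModuleCat.{u} Aᵐᵒᵖ) (a : A) : N →ₗ[k] N where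
  toFun x := MulOpposite.op a • x
  map_add' := smul_add _
  map_smul' c x := by
    change MulOpposite.op a • (algebraMap k Aᵐᵒᵖ c • x) = algebraMap k Aᵐᵒᵖ c • _
    rw [smul_smul, smul_smul, Algebra.commutes]

/-- `D N` is a left `A`-module by `(a • φ) x = φ (x · a)`. -/
noncomputable instance (N : ModuleCat.{u} Aᵐᵒᵖ) : Module A (RightDual k N) where
  smul a φ := φ.lin ∘ₗ rightMul k N a
  one_smul φ := by
    refine LinearMap.ext (M := N) fun x => ?_
    exact congrArg φ.lin (one_smul Aᵐᵒᵖ x)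
  mul_smul a b φ := by
    refine LinearMap.ext (M := N) fun x => ?_
    exact congrArg φ.lin (mul_smul (MulOpposite.op b) (MulOpposite.op a) x)
  smul_zero a := rfl
  smul_add a φ ψ := rfl
  add_smul a b φ := by
    refine LinearMap.ext (M := N) fun x => ?_
    refine (congrArg φ.lin
      (add_smul (MulOpposite.op a) (MulOpposite.op b) x)).trans ?_
    exact map_add φ.lin _ _
  zero_smul φ := by
    refine LinearMap.ext (M := N) fun x => ?_
    refine (congrArg φ.lin (zero_smul Aᵐᵒᵖ x)).trans ?_
    exact map_zero φ.lin

theorem rightDual_smul_apply (N : ModuleCat.{u} Aᵐᵒᵖ) (a : A) (φ : RightDual k N) (x : N) :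
    (a • φ).lin x = φ.lin (MulOpposite.op a • x) := rfl

/-- The duality `D = Hom_k(-, k)` from right to left `A`-modules. -/
noncomputable def dual (N : ModuleCat.{u} Aᵐᵒᵖ) : ModuleCat.{u} A :=
  ModuleCat.of A (RightDual k N)

theorem dual_finite (N : ModuleCat.{u} Aᵐᵒᵖ) [Module.Finite k N] :
    Module.Finite k (dual (A := A) k N) := by
  let e : (N →ₗ[k] k) →ₗ[k] (dual (A := A) k N) :=
    { toFun := fun φ => φ
      map_add' := fun _ _ => rfl
      map_smul' := fun c φ => by
        refine LinearMap.ext (M := N) fun x => ?_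
        exact (map_smul φ c x).symm }
  exact Module.Finite.of_surjective e (fun φ => ⟨φ, rfl⟩)

end Dual

section Translate

variable (k : Type u) [Field k] (A : Type u) [Ring A] [Algebra k A]

/-- The property of a left `A`-module of being finite dimensional over `k`. -/
def isFD : ObjectProperty (ModuleCat.{u} A) := fun M => Module.Finite k M

/-- The category `mod A` of finite dimensional left `A`-modules. -/
abbrev FDMod := (isFD k A).FullSubcategory

variable {k A} in
theorem FDMod.finite_ring (M : FDMod k A) : Module.Finite A M.obj :=
  have : Module.Finite k M.obj := M.property
  Module.Finite.of_restrictScalars_finite k A M.obj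

variable [FiniteDimensional k A]

theorem transpose_finite [IsArtinianRing A] (M : Type u) [AddCommGroup M] [Module A M]
    [Module.Finite A M] : Module.Finite k (transpose A M) := by
  have : Module.Finite k (presOne A M) := Module.Finite.trans A _
  let i : (presOne A M →ₗ[A] A) →ₗ[k] (presOne A M →ₗ[k] A) :=
    { toFun := fun f => f.restrictScalars k
      map_add' := fun _ _ => rfl
      map_smul' := fun _ _ => rfl }
  have hi : Function.Injective i := LinearMap.restrictScalars_injective k
  have : Module.Finite k (presOne A M →ₗ[A] A) := Module.Finite.of_injective i hi
  let q : (presOne A M →ₗ[A] A) →ₗ[k] transpose A M :=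
    { toFun := fun f => Submodule.Quotient.mk (p := LinearMap.range (homToRing (presMap A M))) f
      map_add' := fun _ _ => rfl
      map_smul' := fun c f => by
        change Submodule.Quotient.mk (p := LinearMap.range (homToRing (presMap A M))) (c • f) =
          Submodule.Quotient.mk (p := LinearMap.range (homToRing (presMap A M)))
            (algebraMap k Aᵐᵒᵖ c • f)
        congr 1
        ext x
        change c • f x = f x * algebraMap k A c
        rw [Algebra.smul_def, Algebra.commutes] }
  exact Module.Finite.of_surjective q (Submodule.Quotient.mk_surjective _)

/-- The Auslander-Reiten translate `τ M = D Tr M` in `mod A`. -/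
noncomputable def arTranslate (M : FDMod k A) : FDMod k A :=
  haveI : IsArtinianRing A := IsArtinianRing.of_finite k A
  haveI : Module.Finite A M.obj := M.finite_ring
  ⟨dual k (transpose A M.obj),
    haveI := transpose_finite k A M.obj
    dual_finite k (transpose A M.obj)⟩

end Translate

end FPDim

namespace FPDim

/-! ### Modules over a quotient ring -/

section QuotientRing

variable {A : Type u} [Ring A] {I : Ideal A} [I.IsTwoSided]

/-! Write B for `A ⧸ I`. Restriction of scalars embeds mod B fully faithfully in mod A, so brick
sets over B stay brick sets over A. The key fact is that τ_B M embeds in τ_A M over A; then Hom_B(X,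
τ_B M) = Hom_A(X, τ_B M) embeds in Hom_A(X, τ_A M), the adjacency matrix over B is entrywise at most
the one over A, and the spectral radius is monotone on nonnegative matrices (`rho_mono`).

The embedding is dual to a surjection Tr_A M → Tr_B M (`exists_transpose_surjective`). Let P₁ → P₀ →
M and Q₁ → Q₀ → M be minimal presentations over A and B. Then Q₀ is P₀ / I P₀, while Q₁ is only a
direct summand of P₁ / I P₁. Reducing modulo I and restricting along a section Q₁ → P₁ / I P₁ maps
Hom_A(P₁, A) onto Hom_B(Q₁, B), and takes maps factoring through P₀ to maps factoring through Q₀. -/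

theorem mk_smul {M : Type*} [AddCommGroup M] [Module A M] [Module (A ⧸ I) M]
    [IsScalarTower A (A ⧸ I) M] (a : A) (x : M) : Ideal.Quotient.mk I a • x = a • x := by
  rw [← one_smul (A ⧸ I) x, ← smul_assoc, ← smul_assoc, smul_eq_mul, mul_one, smul_assoc, one_smul]
  rw [← smul_one_smul (A ⧸ I) a x]
  congr 1
  exact (mul_one (Ideal.Quotient.mk I a)).symm

/-- An `A`-linear map between `A ⧸ I`-modules, as an `A ⧸ I`-linear map. -/
def extendQuotient {M N : Type*} [AddCommGroup M] [Module A M] [Module (A ⧸ I) M]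
    [IsScalarTower A (A ⧸ I) M] [AddCommGroup N] [Module A N] [Module (A ⧸ I) N]
    [IsScalarTower A (A ⧸ I) N] (f : M →ₗ[A] N) : M →ₗ[A ⧸ I] N where
  toFun := f
  map_add' := map_add f
  map_smul' b x := by
    obtain ⟨a, rfl⟩ := Ideal.Quotient.mk_surjective b
    rw [mk_smul, map_smul, RingHom.id_apply, mk_smul]

theorem smul_top_le_ker {P N : Type*} [AddCommGroup P] [Module A P] [AddCommGroup N]
    [Module A N] [Module (A ⧸ I) N] [IsScalarTower A (A ⧸ I) N] (f : P →ₗ[A] N) :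
    I • (⊤ : Submodule A P) ≤ LinearMap.ker f := by
  rw [Submodule.smul_le]
  intro a ha x _
  rw [LinearMap.mem_ker, map_smul, ← mk_smul (I := I), Ideal.Quotient.eq_zero_iff_mem.2 ha,
    zero_smul]

/-- The map `P / I P → N` induced by a map from `P` to an `A ⧸ I`-module `N`. -/
noncomputable def descend {P N : Type*} [AddCommGroup P] [Module A P] [AddCommGroup N]
    [Module A N] [Module (A ⧸ I) N] [IsScalarTower A (A ⧸ I) N] (f : P →ₗ[A] N) :
    (P ⧸ (I • (⊤ : Submodule A P))) →ₗ[A ⧸ I] N :=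
  extendQuotient ((I • (⊤ : Submodule A P)).liftQ f (smul_top_le_ker f))

theorem descend_mk {P N : Type*} [AddCommGroup P] [Module A P] [AddCommGroup N]
    [Module A N] [Module (A ⧸ I) N] [IsScalarTower A (A ⧸ I) N] (f : P →ₗ[A] N) (x : P) :
    descend (I := I) f (Submodule.Quotient.mk x) = f x := rfl

/-- For a section `σ` of `P / I P → Q`, the map `Hom_A(P, A) → Hom_{A/I}(Q, A/I)` of right
modules given by reduction modulo `I`. -/
noncomputable def reduceHom {P Q : Type*} [AddCommGroup P] [Module A P] [AddCommGroup Q]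
    [Module (A ⧸ I) Q]
    (σ : Q →ₗ[A ⧸ I] (P ⧸ (I • (⊤ : Submodule A P)))) :
    (P →ₗ[A] A) →ₛₗ[RingHom.op (Ideal.Quotient.mk I)] (Q →ₗ[A ⧸ I] (A ⧸ I)) where
  toFun g := descend (Submodule.mkQ I ∘ₗ g) ∘ₗ σ
  map_add' g h := by
    ext y
    obtain ⟨x, hx⟩ := Submodule.Quotient.mk_surjective _ (σ y)
    simp only [LinearMap.comp_apply, LinearMap.add_apply, ← hx, descend_mk, map_add]
  map_smul' a g := by
    ext y
    obtain ⟨x, hx⟩ := Submodule.Quotient.mk_surjective _ (σ y)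
    simp only [LinearMap.comp_apply, LinearMap.smul_apply, ← hx, descend_mk]
    exact map_mul (Ideal.Quotient.mk I) (g x) a.unop

theorem reduceHom_apply {P Q : Type*} [AddCommGroup P] [Module A P] [AddCommGroup Q]
    [Module (A ⧸ I) Q]
    (σ : Q →ₗ[A ⧸ I] (P ⧸ (I • (⊤ : Submodule A P)))) (g : P →ₗ[A] A)
    {x : P} {y : Q} (h : σ y = Submodule.Quotient.mk x) :
    reduceHom σ g y = Ideal.Quotient.mk I (g x) := by
  change descend _ (σ y) = _
  rw [h, descend_mk]
  rfl

/-! ### Minimal presentations and transposes over `A` and over `A ⧸ I` -/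

variable {P M Q : Type u} [AddCommGroup P] [Module A P]
  [AddCommGroup M] [Module A M] [Module (A ⧸ I) M]
  [AddCommGroup Q] [Module A Q] [Module (A ⧸ I) Q] [IsScalarTower A (A ⧸ I) Q]

/-- A map from a projective module to a module with a projective cover lifts to a
surjection onto the projective cover, if it is itself surjective. -/
theorem exists_surjective_lift [IsScalarTower A (A ⧸ I) M] [Module.Projective A P] {p : P →ₗ[A] M}
    (hp : Function.Surjective p) {q : Q →ₗ[A ⧸ I] M} (hq : IsProjectiveCover q) :
    ∃ f : P →ₗ[A] Q, (∀ x, q (f x) = p x) ∧ Function.Surjective f := by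
  obtain ⟨f, hf⟩ := Module.projective_lifting_property (q.restrictScalars A) p hq.surjective
  have hf' : ∀ x, q (f x) = p x := LinearMap.congr_fun hf
  refine ⟨f, hf', ?_⟩
  -- Superfluity of `ker q` is tested on `A ⧸ I`-submodules, so the image of `f` enters as the range
  -- of its descent.
  have h := hq.superfluous (LinearMap.range (descend (I := I) f)) <| by
    rw [eq_top_iff]
    rintro y -
    obtain ⟨x, hx⟩ := hp (q y)
    refine Submodule.mem_sup.2 ⟨f x, ⟨Submodule.Quotient.mk x, rfl⟩, y - f x, ?_, by abel⟩
    rw [LinearMap.mem_ker, map_sub, hf', hx, sub_self]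
  intro y
  obtain ⟨x, hx⟩ : y ∈ LinearMap.range (descend (I := I) f) := h ▸ Submodule.mem_top
  obtain ⟨x, rfl⟩ := Submodule.Quotient.mk_surjective _ x
  exact ⟨x, hx⟩

/-- Reduction modulo `I` of a projective cover is a projective cover. -/
theorem ker_le_smul_top {p : P →ₗ[A] M} (hp : IsProjectiveCover p) {q : Q →ₗ[A ⧸ I] M}
    [Module.Projective (A ⧸ I) Q] {f : P →ₗ[A] Q} (hf : ∀ x, q (f x) = p x)
    (hfs : Function.Surjective f) : LinearMap.ker f ≤ I • (⊤ : Submodule A P) := by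
  have hds : Function.Surjective (descend (I := I) f) := fun y =>
    let ⟨x, hx⟩ := hfs y
    ⟨Submodule.Quotient.mk x, hx⟩
  obtain ⟨s, hs⟩ := Module.projective_lifting_property (descend (I := I) f) LinearMap.id hds
  have hs' : ∀ y, descend (I := I) f (s y) = y := LinearMap.congr_fun hs
  -- The preimage in `P` of the image of the section `s` meets every coset of `ker p`, so it is all
  -- of `P`. Hence `s` is onto, and `P / I P → Q` is injective.
  have htop := hp.superfluous
    ((LinearMap.range (s.restrictScalars A)).comap (I • (⊤ : Submodule A P)).mkQ) <| by
    rw [eq_top_iff]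
    rintro x -
    obtain ⟨y, hy⟩ := Submodule.Quotient.mk_surjective _ (s (f x))
    refine Submodule.mem_sup.2 ⟨y, ⟨f x, hy.symm⟩, x - y, ?_, by abel⟩
    have : f y = f x := by rw [← descend_mk (I := I) f y, hy, hs']
    rw [LinearMap.mem_ker, map_sub, ← hf, ← hf, this, sub_self]
  intro x hx
  obtain ⟨y, hy⟩ : x ∈ (LinearMap.range (s.restrictScalars A)).comap
    (I • (⊤ : Submodule A P)).mkQ := by rw [htop]; trivial
  have hy' : s y = Submodule.Quotient.mk x := hy
  have : y = 0 := by
    rw [← hs' y, hy', descend_mk, LinearMap.mem_ker.1 hx]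
  rw [← Submodule.Quotient.mk_eq_zero, ← hy', this, map_zero]

/-- Projectivity of `P` lifts `h ∘ f : P → A ⧸ I` to a map `P → A`; since σ is a section of the
descent of `f`, reducing this lift gives back `h`. -/
theorem reduceHom_surjective [Module.Projective A P] {f : P →ₗ[A] Q}
    {σ : Q →ₗ[A ⧸ I] (P ⧸ (I • (⊤ : Submodule A P)))} (hσ : ∀ y, descend f (σ y) = y) :
    Function.Surjective (reduceHom σ) := by
  intro h
  obtain ⟨g, hg⟩ := Module.projective_lifting_property (Submodule.mkQ I)
    ((h.restrictScalars A) ∘ₗ f) (Submodule.mkQ_surjective I)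
  refine ⟨g, LinearMap.ext fun y => ?_⟩
  obtain ⟨x, hx⟩ := Submodule.Quotient.mk_surjective _ (σ y)
  rw [reduceHom_apply σ g hx.symm]
  refine (LinearMap.congr_fun hg x).trans ?_
  change h (f x) = h y
  rw [← descend_mk (I := I) f x, hx, hσ]

variable (I) in
/-- The transpose over `A ⧸ I` of an `A ⧸ I`-module is a quotient of its transpose over `A`. -/
theorem exists_transpose_surjective [IsArtinianRing A] [IsArtinianRing (A ⧸ I)] (M : Type u)
    [AddCommGroup M] [Module A M] [Module (A ⧸ I) M] [IsScalarTower A (A ⧸ I) M]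
    [Module.Finite A M] [Module.Finite (A ⧸ I) M] :
    ∃ t : transpose A M →ₛₗ[RingHom.op (Ideal.Quotient.mk I)] transpose (A ⧸ I) M,
      Function.Surjective t := by
  let : Module A (presZero (A ⧸ I) M) := Module.compHom _ (Ideal.Quotient.mk I)
  have : IsScalarTower A (A ⧸ I) (presZero (A ⧸ I) M) :=
    ⟨fun a b x => mul_smul (Ideal.Quotient.mk I a) b x⟩
  let : Module A (presOne (A ⧸ I) M) := Module.compHom _ (Ideal.Quotient.mk I)
  have : IsScalarTower A (A ⧸ I) (presOne (A ⧸ I) M) :=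
    ⟨fun a b x => mul_smul (Ideal.Quotient.mk I a) b x⟩
  let p := projCoverMap A M
  let q := projCoverMap (A ⧸ I) M
  have hp : IsProjectiveCover p := projCoverMap_isProjectiveCover A M
  have hq : IsProjectiveCover q := projCoverMap_isProjectiveCover (A ⧸ I) M
  let p₁ := projCoverMap A (LinearMap.ker p)
  let q₁ := projCoverMap (A ⧸ I) (LinearMap.ker q)
  have hp₁ : IsProjectiveCover p₁ := projCoverMap_isProjectiveCover A _
  have hq₁ : IsProjectiveCover q₁ := projCoverMap_isProjectiveCover (A ⧸ I) _
  have := hp.projective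
  have := hq.projective
  have := hp₁.projective
  have := hq₁.projective
  obtain ⟨f, hf, hfs⟩ := exists_surjective_lift hp.surjective hq
  have hker := ker_le_smul_top hp hf hfs
  let fK : LinearMap.ker p →ₗ[A] LinearMap.ker q :=
    { toFun := fun x => ⟨f x, by rw [LinearMap.mem_ker, hf]; exact x.2⟩
      map_add' := fun x y => Subtype.ext (map_add f x.1 y.1)
      map_smul' := fun a x => Subtype.ext (map_smul f a x.1) }
  have hfK : Function.Surjective fK := by
    rintro ⟨y, hy⟩
    obtain ⟨x, rfl⟩ := hfs y
    exact ⟨⟨x, by rw [LinearMap.mem_ker, ← hf]; exact hy⟩, rfl⟩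
  obtain ⟨f₁, hf₁, hf₁s⟩ := exists_surjective_lift (p := fK ∘ₗ p₁)
    (hfK.comp hp₁.surjective) hq₁
  have hpres : ∀ x, presMap (A ⧸ I) M (f₁ x) = f (presMap A M x) := fun x =>
    congrArg Subtype.val (hf₁ x)
  have hds : Function.Surjective (descend (I := I) f₁) := fun y =>
    let ⟨x, hx⟩ := hf₁s y
    ⟨Submodule.Quotient.mk x, hx⟩
  -- `P₁ / I P₁` may be strictly larger than `Q₁`, so a splitting has to be chosen; it exists
  -- because `Q₁` is projective.
  obtain ⟨σ, hσ⟩ := Module.projective_lifting_property (descend (I := I) f₁) LinearMap.id hds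
  have hσ' : ∀ y, descend (I := I) f₁ (σ y) = y := LinearMap.congr_fun hσ
  have hle : LinearMap.range (homToRing (presMap A M)) ≤
      (LinearMap.range (homToRing (presMap (A ⧸ I) M))).comap (reduceHom σ) := by
    rintro _ ⟨v, rfl⟩
    let v' : presZero A M →ₗ[A] (A ⧸ I) := Submodule.mkQ I ∘ₗ v
    -- Minimality of `P₀` enters here: `ker f` lies in `I P₀`, which every map to `A ⧸ I` kills, so
    -- `v'` factors through `f`.
    have hv : LinearMap.ker f ≤ LinearMap.ker v' := hker.trans (smul_top_le_ker v')
    let w : presZero (A ⧸ I) M →ₗ[A ⧸ I] (A ⧸ I) := extendQuotient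
      (((LinearMap.ker f).liftQ v' hv) ∘ₗ
        (f.quotKerEquivOfSurjective hfs).symm.toLinearMap)
    have hw : ∀ x, w (f x) = v' x := by
      intro x
      change (LinearMap.ker f).liftQ v' hv ((f.quotKerEquivOfSurjective hfs).symm (f x)) = _
      have : (f.quotKerEquivOfSurjective hfs).symm (f x) = Submodule.Quotient.mk x := by
        rw [LinearEquiv.symm_apply_eq]
        rfl
      rw [this]
      rfl
    refine ⟨w, LinearMap.ext fun y => ?_⟩
    obtain ⟨x, hx⟩ := Submodule.Quotient.mk_surjective _ (σ y)
    rw [reduceHom_apply σ _ hx.symm]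
    have hy : f₁ x = y := by rw [← hσ' y, ← hx, descend_mk]
    change w (presMap (A ⧸ I) M y) = _
    rw [← hy, hpres, hw]
    rfl
  refine ⟨Submodule.mapQ _ _ (reduceHom σ) hle, ?_⟩
  intro z
  obtain ⟨h, rfl⟩ := Submodule.Quotient.mk_surjective _ z
  obtain ⟨g, rfl⟩ := reduceHom_surjective hσ' h
  exact ⟨Submodule.Quotient.mk g, rfl⟩

end QuotientRing

/-! ### Monotonicity of the spectral radius -/

section SpectralRadius

variable {n : ℕ}

-- Gelfand's formula reduces the claim to norms of powers. Powers of nonnegative matrices preserve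
-- the entrywise order, and so does the maximal row sum norm.
attribute [local instance] Matrix.linftyOpNormedRing Matrix.linftyOpNormedAlgebra in
theorem spectralRadius_mono {M N : Matrix (Fin n) (Fin n) ℝ} (h0 : ∀ i j, 0 ≤ M i j)
    (h : ∀ i j, M i j ≤ N i j) :
    spectralRadius ℂ (M.map (fun r : ℝ => (r : ℂ))) ≤
      spectralRadius ℂ (N.map (fun r : ℝ => (r : ℂ))) := by
  have hpow : ∀ m : ℕ, ∀ i j, 0 ≤ (M ^ m) i j ∧ (M ^ m) i j ≤ (N ^ m) i j := by
    intro m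
    induction m with
    | zero =>
      intro i j
      simp only [pow_zero, le_refl, and_true, Matrix.one_apply]
      split_ifs <;> norm_num
    | succ m ih =>
      intro i j
      simp only [pow_succ, Matrix.mul_apply]
      exact ⟨Finset.sum_nonneg fun l _ => mul_nonneg (ih i l).1 (h0 l j),
        Finset.sum_le_sum fun l _ => mul_le_mul (ih i l).2 (h l j) (h0 l j)
          ((ih i l).1.trans (ih i l).2)⟩
  have hmap : ∀ (L : Matrix (Fin n) (Fin n) ℝ) (m : ℕ),
      (L.map (fun r : ℝ => (r : ℂ))) ^ m = (L ^ m).map (fun r : ℝ => (r : ℂ)) := fun L m =>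
    (map_pow (Complex.ofRealHom.mapMatrix (m := Fin n)) L m).symm
  refine le_of_tendsto_of_tendsto'
    (spectrum.pow_nnnorm_pow_one_div_tendsto_nhds_spectralRadius _)
    (spectrum.pow_nnnorm_pow_one_div_tendsto_nhds_spectralRadius _) fun m => ?_
  refine ENNReal.rpow_le_rpow ?_ (by positivity)
  rw [hmap, hmap, ENNReal.coe_le_coe, Matrix.linfty_opNNNorm_def, Matrix.linfty_opNNNorm_def]
  refine Finset.sup_mono_fun fun i _ => Finset.sum_le_sum fun j _ => ?_
  rw [← NNReal.coe_le_coe]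
  simp only [Matrix.map_apply, coe_nnnorm, Complex.norm_real, Real.norm_eq_abs]
  rw [abs_of_nonneg (hpow m i j).1, abs_of_nonneg ((hpow m i j).1.trans (hpow m i j).2)]
  exact (hpow m i j).2

theorem realRho_mono {M N : Matrix (Fin n) (Fin n) ℝ} (h0 : ∀ i j, 0 ≤ M i j)
    (h : ∀ i j, M i j ≤ N i j) : realRho M ≤ realRho N :=
  EReal.coe_ennreal_le_coe_ennreal_iff.2 (spectralRadius_mono h0 h)

theorem rho_mono {M N : Matrix (Fin n) (Fin n) EReal} (h0 : ∀ i j, 0 ≤ M i j)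
    (h : ∀ i j, M i j ≤ N i j) : rho M ≤ rho N := by
  refine Filter.liminf_le_liminf ?_
  -- The bound 0 keeps the replaced entries nonnegative; the bound `(M i j).toReal` is needed where
  -- `N i j = ⊤` and `M i j` is finite.
  filter_upwards [Filter.eventually_ge_atTop fun i j => max 0 (M i j).toReal] with x hx
  have hx' : ∀ i j, max 0 (M i j).toReal ≤ x i j := fun i j => hx i j
  have hbot : ∀ i j, M i j ≠ ⊥ := fun i j => ((EReal.bot_lt_zero).trans_le (h0 i j)).ne'
  have hbot' : ∀ i j, N i j ≠ ⊥ := fun i j =>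
    ((EReal.bot_lt_zero).trans_le ((h0 i j).trans (h i j))).ne'
  refine realRho_mono (fun i j => ?_) fun i j => ?_
  · simp only [realize, Matrix.of_apply, hbot i j, if_false]
    split_ifs
    · exact (le_max_left _ _).trans (hx' i j)
    · exact EReal.toReal_nonneg (h0 i j)
  · simp only [realize, Matrix.of_apply, hbot i j, hbot' i j, if_false]
    by_cases hN : N i j = ⊤
    · rw [if_pos hN]
      split_ifs
      · exact le_rfl
      · exact (le_max_right _ _).trans (hx' i j)
    · have hM : M i j ≠ ⊤ := fun e => hN (top_le_iff.1 (e ▸ h i j))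
      rw [if_neg hN, if_neg hM]
      exact EReal.toReal_le_toReal (h i j) (hbot i j) hN

end SpectralRadius

/-! ### Comparison of the Auslander-Reiten translates -/

section Restriction

variable (k : Type u) [Field k] {A : Type u} [Ring A] [Algebra k A] (I : Ideal A)
  [I.IsTwoSided]

variable {k I} in
/-- The dual of a map of right modules over `A → A ⧸ I`, as a map on the underlying spaces. -/
noncomputable def dualMap {N : ModuleCat.{u} Aᵐᵒᵖ} {N' : ModuleCat.{u} (A ⧸ I)ᵐᵒᵖ}
    (t : N →ₛₗ[RingHom.op (Ideal.Quotient.mk I)] N') (φ : RightDual k N') : RightDual k N :=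
  let t' : N →ₗ[k] N' :=
    { toFun := t
      map_add' := map_add t
      -- Scalars of `k` act through `algebraMap`, and the quotient map carries that of `A` to that
      -- of `A ⧸ I`, so semilinearity gives `k`-linearity.
      map_smul' := fun c x => t.map_smulₛₗ (algebraMap k Aᵐᵒᵖ c) x }
  φ.lin ∘ₗ t'

theorem dualMap_smul {N : ModuleCat.{u} Aᵐᵒᵖ} {N' : ModuleCat.{u} (A ⧸ I)ᵐᵒᵖ}
    (t : N →ₛₗ[RingHom.op (Ideal.Quotient.mk I)] N') (a : A) (φ : RightDual k N') :
    dualMap t (Ideal.Quotient.mk I a • φ) = a • dualMap t φ :=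
  LinearMap.ext (M := N) fun x => congrArg φ.lin (t.map_smulₛₗ (MulOpposite.op a) x).symm

variable {I} in
theorem dualMap_injective {N : ModuleCat.{u} Aᵐᵒᵖ} {N' : ModuleCat.{u} (A ⧸ I)ᵐᵒᵖ}
    {t : N →ₛₗ[RingHom.op (Ideal.Quotient.mk I)] N'} (ht : Function.Surjective t) :
    Function.Injective (dualMap (k := k) t) := by
  intro φ ψ h
  refine LinearMap.ext (M := N') fun y => ?_
  obtain ⟨x, rfl⟩ := ht y
  exact LinearMap.congr_fun (M := N) h x

/-- An `A ⧸ I`-module as an `A`-module. -/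
noncomputable def restrict (M : FDMod k (A ⧸ I)) : FDMod k A :=
  ⟨(ModuleCat.restrictScalars (Ideal.Quotient.mk I)).obj M.obj, M.property⟩

/-- The inclusion of `mod (A ⧸ I)` in `mod A` on morphisms. -/
noncomputable def restrictHom (X Y : FDMod k (A ⧸ I)) :
    (X ⟶ Y) ≃ₗ[k] (restrict k I X ⟶ restrict k I Y) where
  toFun f := ⟨(ModuleCat.restrictScalars (Ideal.Quotient.mk I)).map f.hom⟩
  invFun f := ⟨ModuleCat.ofHom
    { toFun := f.hom.hom
      map_add' := map_add f.hom.hom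
      map_smul' := fun b x => by
        obtain ⟨a, rfl⟩ := Ideal.Quotient.mk_surjective b
        exact f.hom.hom.map_smul a (show (restrict k I X).obj from x) }⟩
  map_add' f g := rfl
  map_smul' c f := rfl
  left_inv f := rfl
  right_inv f := rfl

theorem IsBrickSet.restrict {n : ℕ} {X : Fin n → FDMod k (A ⧸ I)} (hX : IsBrickSet k X) :
    IsBrickSet k fun i => restrict k I (X i) := fun i j =>
  (restrictHom k I (X i) (X j)).rank_eq.symm.trans (hX i j)

variable [FiniteDimensional k A]

/-- The translate over `A ⧸ I` of an `A ⧸ I`-module is a submodule of its translate over `A`. -/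
theorem exists_arTranslate_mono (M : FDMod k (A ⧸ I)) :
    ∃ f : restrict k I (arTranslate k (A ⧸ I) M) ⟶ arTranslate k A (restrict k I M),
      Function.Injective f.hom.hom := by
  have : IsArtinianRing A := IsArtinianRing.of_finite k A
  have : IsArtinianRing (A ⧸ I) := IsArtinianRing.of_finite k (A ⧸ I)
  -- This is definitionally the module structure of `restrict k I M`, so the two transposes over `A`
  -- coincide.
  let : Module A M.obj := Module.compHom _ (Ideal.Quotient.mk I)
  have : IsScalarTower A (A ⧸ I) M.obj :=
    ⟨fun a b x => mul_smul (Ideal.Quotient.mk I a) b x⟩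
  have : Module.Finite (A ⧸ I) M.obj := M.finite_ring
  have hfin : Module.Finite A (restrict k I M).obj := (restrict k I M).finite_ring
  have : Module.Finite A M.obj := hfin
  obtain ⟨t, ht⟩ := exists_transpose_surjective I M.obj
  let g : (restrict k I (arTranslate k (A ⧸ I) M)).obj →ₗ[A]
      dual k (transpose A (restrict k I M).obj) :=
    { toFun := dualMap (k := k) t
      map_add' := fun _ _ => rfl
      map_smul' := dualMap_smul k I t }
  let h : (restrict k I (arTranslate k (A ⧸ I) M)).obj ⟶
      (arTranslate k A (restrict k I M)).obj :=
    ModuleCat.homEquiv.symm g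
  exact ⟨⟨h⟩, dualMap_injective k ht⟩

/-- Full faithfulness of restriction moves the left side to mod A, where composing with the
embedding of translates is injective on Hom. -/
theorem homDim_arTranslate_le (X M : FDMod k (A ⧸ I)) :
    homDim k X (arTranslate k (A ⧸ I) M) ≤
      homDim k (restrict k I X) (arTranslate k A (restrict k I M)) := by
  obtain ⟨f, hf⟩ := exists_arTranslate_mono k I M
  refine EReal.coe_ennreal_le_coe_ennreal_iff.2 (ENat.toENNReal_le.2 (OrderHomClass.mono _ ?_))
  rw [(restrictHom k I X _).rank_eq]
  refine LinearMap.rank_le_of_injective (Linear.rightComp k (restrict k I X) f) ?_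
  intro g h hgh
  refine ObjectProperty.hom_ext _ (ModuleCat.hom_ext (LinearMap.ext fun x => hf ?_))
  exact congrArg (fun u => u.hom.hom x) hgh

end Restriction

end FPDim

theorem mainTheorem7 (k : Type u) [Field k] [IsAlgClosed k]
    (A : Type u) [Ring A] [Algebra k A] [FiniteDimensional k A]
    (I : Ideal A) [I.IsTwoSided] :
    FPDim.fpd k (FPDim.arTranslate k (A ⧸ I)) ≤ FPDim.fpd k (FPDim.arTranslate k A) := by
  refine iSup_mono fun n => iSup_le fun X => ?_
  -- The competing brick set over `A` is the restricted one, of the same size.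
  refine le_trans ?_ (le_iSup _ ⟨fun i => FPDim.restrict k I (X.1 i), X.2.restrict⟩)
  exact FPDim.rho_mono (fun i j => EReal.coe_ennreal_nonneg _)
    fun i j => FPDim.homDim_arTranslate_le k I (X.1 i) (X.1 j)
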